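/- Let $K$ be a number field with algebraic closure $\overline K$, let $T$ be a finite set of places of $K$ (finite or infinite), and let $G$ be a finite group with a normal series \[ \{1\}=G_0\le G_1\le\cdots\le G_m=G,\qquad G_i\trianglelefteq G . \] For a number field $L\subset\overline K$ and a set $T'$ of places of $L$, let $G_L^{T'}$ denote the Galois group over $L$ of the maximal extension of $L$ in $\overline K$ unramified outside $T'$ (a real place outside $T'$ has to stay real), let $\mathrm{Hom}(G_L^{T'},A)$ be the set of continuous homomorphisms to a finite discrete group $A$, and for $L\supseteq K$ let $T(L)$ be the set of places of $L$ lying above a place in $T$. Then $\mathrm{Hom}(G_K^T,G)$ is finite, and there are finite Galois extensions $L_{i,T}/K$ in $\overline K$, $i=1,\dots,m$, unramified outside $T$, with $L_{m,T}=K$ (if $m\ge 1$), such that for every $i$ there is an injective homomorphism \[ \mathrm{Gal}(L_{i,T}/K)\hookrightarrow (G/G_{i-1})/C_G(G_i/G_{i-1}), \] where $C_G(G_i/G_{i-1})$ is the centralizer of $G_i/G_{i-1}$ in $G/G_{i-1}$, each set $\mathrm{Hom}\big(G_{L_{i,T}}^{T(L_{i,T})},G_i/G_{i-1}\big)$ is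 finite, and \[ |\mathrm{Hom}(G_K^T,G)|\le\prod_{i=1}^m|\mathrm{Gal}(L_{i,T}/K)|^{|G/G_{i-1}|}\cdot\big|\mathrm{Hom}\big(G_{L_{i,T}}^{T(L_{i,T})},G_i/G_{i-1}\big)\big| . \] -/

import Mathlib

open NumberField IsDedekindDomain

/-- The places of a number field `K`: the nonzero primes of its ring of integers (finite places)
together with the infinite places. -/
abbrev NFPlace (K : Type*) [Field K] : Type _ :=
  HeightOneSpectrum (𝓞 K) ⊕ InfinitePlace K

/-- `PlaceAbove K L w v`: the place `w` of `L` lies above the place `v` of `K`. -/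
def PlaceAbove (K L : Type*) [Field K] [Field L] [Algebra K L] : NFPlace L → NFPlace K → Prop
  | Sum.inl w, Sum.inl v => w.asIdeal.LiesOver v.asIdeal
  | Sum.inr w, Sum.inr v => w.comap (algebraMap K L) = v
  | _, _ => False

/-- `T(L)`: the set of places of `L` lying above a place in `T`. -/
def placesAbove {K : Type*} [Field K] (T : Set (NFPlace K)) (L : Type*) [Field L] [Algebra K L] :
    Set (NFPlace L) :=
  {w | ∃ v ∈ T, PlaceAbove K L w v}

/-- The extension `L/K` of number fields is unramified outside `T`. A real place of `K` is
unramified in `L` when all the places of `L` above it are real. -/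
def UnramifiedOutside (K L : Type*) [Field K] [Field L] [Algebra K L] (T : Set (NFPlace K)) :
    Prop :=
  (∀ v : HeightOneSpectrum (𝓞 K), Sum.inl v ∉ T → Algebra.IsUnramifiedIn (𝓞 L) v.asIdeal) ∧
  (∀ v : InfinitePlace K, Sum.inr v ∉ T → v.IsUnramifiedIn L)

/-- The maximal extension of `K` inside `Ω` (an algebraic closure of `K`) that is unramified
outside `T`: the compositum of all finite subextensions unramified outside `T`. -/
def maxUnramifiedOutside (K Ω : Type*) [Field K] [Field Ω] [Algebra K Ω] (T : Set (NFPlace K)) :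
    IntermediateField K Ω :=
  sSup {F : IntermediateField K Ω | FiniteDimensional K F ∧ UnramifiedOutside K F T}

/-- `G_K^T`: the Galois group of the maximal extension of `K` unramified outside `T`; it carries
the Krull topology. -/
abbrev GaloisGroupOutside (K Ω : Type*) [Field K] [Field Ω] [Algebra K Ω]
    (T : Set (NFPlace K)) : Type _ :=
  Gal(maxUnramifiedOutside K Ω T/K)

/-- Continuous homomorphisms from a topological group `H` to a group `A` with the discrete
topology. -/
abbrev DiscreteHom (H A : Type*) [Group H] [TopologicalSpace H] [Group A] : Type _ :=
  @ContinuousMonoidHom H A _ _ _ (⊥ : TopologicalSpace A)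

/-- A normal series `1 = G₀ ≤ G₁ ≤ ⋯ ≤ G_m = G` with every `G_i` normal in `G`. -/
structure NormalSeries (G : Type*) [Group G] (m : ℕ) where
  /-- The terms `G_0, …, G_m`. -/
  term : Fin (m + 1) → Subgroup G
  mono : Monotone term
  normal : ∀ i, (term i).Normal
  term_zero : term 0 = ⊥
  term_last : term (Fin.last m) = ⊤

namespace NormalSeries

variable {G : Type*} [Group G] {m : ℕ} (S : NormalSeries G m)

instance (i : Fin (m + 1)) : (S.term i).Normal := S.normal i

/-! The index `i : Fin m` below stands for the usual index `i + 1 ∈ {1, …, m}`. -/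

/-- The quotient `G/G_{i-1}`. -/
abbrev Quot (i : Fin m) : Type _ := G ⧸ S.term i.castSucc

/-- The factor `G_i/G_{i-1}`, as a subgroup of `G/G_{i-1}`. -/
def factor (i : Fin m) : Subgroup (S.Quot i) :=
  (S.term i.succ).map (QuotientGroup.mk' (S.term i.castSucc))

instance (i : Fin m) : (S.factor i).Normal :=
  Subgroup.Normal.map (S.normal i.succ) _ (QuotientGroup.mk'_surjective _)

/-- The group `(G/G_{i-1})/C_G(G_i/G_{i-1})`, the centralizer being that of `G_i/G_{i-1}` in
`G/G_{i-1}`. -/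
abbrev ActingQuot (i : Fin m) : Type _ :=
  S.Quot i ⧸ Subgroup.centralizer (S.factor i : Set (S.Quot i))

end NormalSeries

/-! Continuous homomorphisms from `G_K^T` are homomorphisms from `Gal(Ω/K)` with open kernel that
kill the automorphisms fixing the maximal extension unramified outside `T`. They can thus be
composed with quotient maps and restricted to subgroups `Gal(Ω/L)`.

The count goes down the quotients `G/G_{i-1} → G/G_i`: the homomorphisms to the source number at
most those to the target times the size of the largest fibre. Let `φ₀` lie in that fibre, put `A =
G_i/G_{i-1}`, and let `L` be cut out by `φ₀` modulo the centralizer of `A`; this gives the embedding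
of `Gal(L/K)`. On `Gal(Ω/L)` the values of `φ₀` commute with `A`, so `φ ↦ φ φ₀⁻¹` turns the fibre
into homomorphisms to `A`, unramified outside `T(L)`. What is lost is the value of `φ φ₀⁻¹` at the
`g - 1` nontrivial cosets, where `g = [L : K]` (`ncard_le_of_centralizer`). With `b = |G/G_{i-1}|`
this costs at most `|A| ^ (g - 1) ≤ b ^ (g - 1) ≤ g ^ b`. For `i = m` the target is trivial, `φ₀ =
1` is allowed, and `L = K`.

Finiteness is Hermite–Minkowski: for fixed degree the different, hence the discriminant, of a Galois
extension unramified outside `T` is bounded (`differentIdeal_dvd_of_unramifiedOutside`). -/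

/-! ### Ramification of finite primes through inertia groups -/

section Inertia

variable {K F N : Type*} [Field K] [Field F] [Field N] [NumberField K] [NumberField F]
  [NumberField N] [Algebra K F] [Algebra F N] [Algebra K N] [IsScalarTower K F N] [IsGalois K N]

/-- In a tower `N/F/K` with `N/K` Galois, the prime of `F` below `Q` is unramified over `K` if and
only if the inertia group of `Q` in `Gal(N/K)` acts trivially on `F`. -/
theorem ramificationIdx_under_eq_one_iff_inertia (Q : Ideal (𝓞 N)) [Q.IsPrime] :
    (Q.under (𝓞 F)).ramificationIdx (𝓞 K) = 1 ↔
      ∀ σ ∈ Q.inertia Gal(N/K), ∀ x : F, σ (algebraMap F N x) = algebraMap F N x := by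
  have : IsGalois F N := IsGalois.tower_top_of_isGalois K F N
  have hK : Nat.card (Q.inertia Gal(N/K)) = Q.ramificationIdx (𝓞 K) := by
    rw [Ideal.card_inertia_eq_ramificationIdxIn (Q.under (𝓞 K)) Q,
      Ideal.ramificationIdxIn_eq_ramificationIdx (Q.under (𝓞 K)) Q Gal(N/K)]
  have hF : Nat.card (Q.inertia Gal(N/F)) = Q.ramificationIdx (𝓞 F) := by
    rw [Ideal.card_inertia_eq_ramificationIdxIn (Q.under (𝓞 F)) Q,
      Ideal.ramificationIdxIn_eq_ramificationIdx (Q.under (𝓞 F)) Q Gal(N/F)]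
  -- Orders of inertia groups are ramification indices, so by multiplicativity the index of the
  -- middle prime is 1 exactly when the inertia group over `F` fills the one over `K`.
  have htower := Ideal.ramificationIdx_tower (R := 𝓞 K) (Q.under (𝓞 F)) Q
  rw [← hK, ← hF] at htower
  let ι : Gal(N/F) →* Gal(N/K) := AlgEquiv.restrictScalarsHom K
  have hι : Function.Injective ι := AlgEquiv.restrictScalars_injective K
  have hcomap : ∀ τ : Gal(N/F), ι τ ∈ Q.inertia Gal(N/K) ↔ τ ∈ Q.inertia Gal(N/F) :=
    fun _ ↦ Iff.rfl
  have hle : (Q.inertia Gal(N/F)).map ι ≤ Q.inertia Gal(N/K) := by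
    rintro _ ⟨τ, hτ, rfl⟩
    exact (hcomap τ).2 hτ
  have hcard : Nat.card ((Q.inertia Gal(N/F)).map ι) = Nat.card (Q.inertia Gal(N/F)) :=
    Nat.card_congr ((Q.inertia Gal(N/F)).equivMapOfInjective ι hι).toEquiv.symm
  constructor
  · intro h σ hσ x
    rw [h, one_mul, ← hcard] at htower
    rw [← Subgroup.eq_of_le_of_card_ge hle htower.le] at hσ
    obtain ⟨τ, -, rfl⟩ := hσ
    exact τ.commutes x
  · intro h
    have heq : (Q.inertia Gal(N/F)).map ι = Q.inertia Gal(N/K) := by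
      refine le_antisymm hle fun σ hσ ↦ ?_
      let τ : Gal(N/F) := AlgEquiv.ofRingEquiv (f := σ.toRingEquiv) (h σ hσ)
      have hτ : ι τ = σ := by ext; rfl
      exact ⟨τ, (hcomap τ).1 (hτ ▸ hσ), hτ⟩
    rw [← heq, hcard] at htower
    exact (Nat.eq_of_mul_eq_mul_right Nat.card_pos (by rw [← htower, one_mul]))

/-- A prime `v` of `K` is unramified in `F` if and only if the inertia groups of the primes above
`v` of a Galois extension `N/K` containing `F` act trivially on `F`. -/
theorem isUnramifiedIn_iff_inertia (v : Ideal (𝓞 K)) :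
    Algebra.IsUnramifiedIn (𝓞 F) v ↔
      ∀ Q : Ideal (𝓞 N), Q.IsPrime → Q.LiesOver v → ∀ σ ∈ Q.inertia Gal(N/K), ∀ x : F,
        σ (algebraMap F N x) = algebraMap F N x := by
  rw [Algebra.isUnramifiedIn_iff_forall_ramificationIdx_eq_one]
  constructor
  · intro h Q _ hQ
    rw [← ramificationIdx_under_eq_one_iff_inertia]
    refine h _ ⟨?_⟩
    rw [Ideal.under_under]
    exact hQ.over
  · intro h q _ hq
    obtain ⟨Q, hQ, hQq⟩ := Ideal.exists_ideal_over_prime_of_isIntegral (S := 𝓞 N) q ⊥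
      (by simp [Ideal.comap_bot_of_injective _ (FaithfulSMul.algebraMap_injective (𝓞 F) (𝓞 N))])
    obtain ⟨hQ, rfl⟩ := hQq
    exact (ramificationIdx_under_eq_one_iff_inertia Q).2
      (h Q hQ ⟨by rw [← Ideal.under_under (B := 𝓞 F)]; exact hq.over⟩)

end Inertia

/-! ### Unramified extensions in towers -/

section UnramifiedOutside

variable {K F F' : Type*} [Field K] [Field F] [Field F'] [Algebra K F] [Algebra K F']
  {T : Set (NFPlace K)}

theorem UnramifiedOutside.self : UnramifiedOutside K K T := by
  refine ⟨fun v _ q _ _ ↦ ?_, fun v _ w _ ↦ ?_⟩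
  · exact inferInstanceAs (Algebra.FormallyUnramified (𝓞 K) (Localization.AtPrime q))
  · rw [InfinitePlace.isUnramified_iff]
    exact w.isReal_or_isComplex.imp_right fun h ↦ by simpa using! h

theorem UnramifiedOutside.tower_top [Algebra F' F] [IsScalarTower K F' F]
    (h : UnramifiedOutside K F T) : UnramifiedOutside F' F (placesAbove T F') := by
  constructor
  · intro w hw Q hQ hQw
    have hv : Sum.inl (w.under (𝓞 K)) ∉ T :=
      fun hT ↦ hw ⟨_, hT, show w.asIdeal.LiesOver _ from ⟨rfl⟩⟩
    have : Algebra.IsUnramifiedAt (𝓞 K) Q := h.1 _ hv Q hQ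
      ⟨by rw [← Ideal.under_under (B := 𝓞 F'), ← hQw.over]; rfl⟩
    exact Algebra.IsUnramifiedAt.of_restrictScalars (𝓞 K) Q
  · intro w hw u hu
    have hv : Sum.inr (w.comap (algebraMap K F')) ∉ T := fun hT ↦ hw ⟨_, hT, rfl⟩
    refine (h.2 _ hv u ?_).of_restrictScalars F'
    rw [← hu, ← InfinitePlace.comap_comp, ← IsScalarTower.algebraMap_eq]

variable [NumberField K] [NumberField F] [NumberField F']

theorem UnramifiedOutside.of_algHom (h : UnramifiedOutside K F T) (f : F' →ₐ[K] F) :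
    UnramifiedOutside K F' T := by
  let _ : Algebra F' F := f.toAlgebra
  have : IsScalarTower K F' F := IsScalarTower.of_algebraMap_eq' f.comp_algebraMap.symm
  constructor
  · intro v hv q hq hqv
    obtain ⟨Q, -, hQ, rfl⟩ := Ideal.exists_ideal_over_prime_of_isIntegral (S := 𝓞 F) q ⊥
      (by simp [Ideal.comap_bot_of_injective _ (FaithfulSMul.algebraMap_injective (𝓞 F') (𝓞 F))])
    have : Algebra.IsUnramifiedAt (𝓞 K) Q :=
      h.1 v hv Q hQ ⟨by rw [← Ideal.under_under (B := 𝓞 F')]; exact hqv.over⟩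
    have : Q.LiesOver (Q.comap (algebraMap (𝓞 F') (𝓞 F))) := ⟨rfl⟩
    exact Algebra.IsUnramifiedAt.of_liesOver (𝓞 K) _ Q
  · intro v hv w hw
    obtain ⟨u, rfl⟩ := InfinitePlace.comap_surjective (K := F) w
    refine (h.2 v hv u ?_).comap_algHom f
    rw [← hw, ← InfinitePlace.comap_comp, ← IsScalarTower.algebraMap_eq]

end UnramifiedOutside

/-! ### Composita and the maximal extension unramified outside `T` -/

section Sup

variable {K Ω : Type*} [Field K] [Field Ω] [Algebra K Ω] {T : Set (NFPlace K)}

/-- If a complex embedding of the compositum is real on `K`, the locus where it equals its conjugate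
is a subfield; it contains `F₁` and `F₂`, hence everything. -/
theorem isUnramifiedIn_infinitePlace_sup {F₁ F₂ : IntermediateField K Ω}
    {v : InfinitePlace K} (h₁ : v.IsUnramifiedIn F₁) (h₂ : v.IsUnramifiedIn F₂) :
    v.IsUnramifiedIn (F₁ ⊔ F₂ : IntermediateField K Ω) := by
  intro w hw
  rw [← InfinitePlace.mk_embedding w, InfinitePlace.isUnramified_mk_iff_isUnmixed]
  intro hreal
  set φ := w.embedding
  have hv : v = InfinitePlace.mk (φ.comp (algebraMap K _)) := by
    rw [← hw, ← InfinitePlace.comap_mk, InfinitePlace.mk_embedding]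
  let R : IntermediateField K (F₁ ⊔ F₂ : IntermediateField K Ω) :=
    { (RingHom.eqLocusField φ (ComplexEmbedding.conjugate φ)) with
      algebraMap_mem' := fun x ↦ (RingHom.congr_fun hreal x).symm }
  have key : ∀ F : IntermediateField K Ω, ∀ hF : F ≤ F₁ ⊔ F₂, v.IsUnramifiedIn F →
      F ≤ R.map (F₁ ⊔ F₂ : IntermediateField K Ω).val := by
    intro F hF hu x hx
    have h := hu (InfinitePlace.mk (φ.comp (IntermediateField.inclusion hF).toRingHom))
      (by rw [InfinitePlace.comap_mk, hv]; rfl)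
    rw [InfinitePlace.isUnramified_mk_iff_isUnmixed] at h
    exact ⟨⟨x, hF hx⟩, (RingHom.congr_fun (h hreal) ⟨x, hx⟩).symm, rfl⟩
  have hle : F₁ ⊔ F₂ ≤ R.map (F₁ ⊔ F₂ : IntermediateField K Ω).val :=
    sup_le (key F₁ le_sup_left h₁) (key F₂ le_sup_right h₂)
  refine RingHom.ext fun x ↦ ?_
  obtain ⟨y, hy, hyx⟩ := hle x.2
  rw [← show y = x from Subtype.ext hyx]
  exact hy.symm

theorem le_maxUnramifiedOutside {F : IntermediateField K Ω} [FiniteDimensional K F]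
    (h : UnramifiedOutside K F T) : F ≤ maxUnramifiedOutside K Ω T :=
  le_sSup ⟨inferInstance, h⟩

variable [NumberField K]

theorem UnramifiedOutside.of_le {F F' : IntermediateField K Ω} [FiniteDimensional K F]
    (h : UnramifiedOutside K F T) (hle : F' ≤ F) : UnramifiedOutside K F' T := by
  have : FiniteDimensional K F' := .of_injective (IntermediateField.inclusion hle).toLinearMap
    (IntermediateField.inclusion_injective hle)
  have := NumberField.of_module_finite K F
  have := NumberField.of_module_finite K F'
  exact h.of_algHom (IntermediateField.inclusion hle)

variable (K Ω T) in
theorem UnramifiedOutside.bot : UnramifiedOutside K (⊥ : IntermediateField K Ω) T := by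
  have := NumberField.of_module_finite K (⊥ : IntermediateField K Ω)
  exact UnramifiedOutside.self.of_algHom (IntermediateField.botEquiv K Ω).toAlgHom

theorem UnramifiedOutside.map {F : IntermediateField K Ω} [FiniteDimensional K F]
    (h : UnramifiedOutside K F T) (σ : Ω →ₐ[K] Ω) : UnramifiedOutside K (F.map σ) T := by
  have e := F.equivMap σ
  have : FiniteDimensional K (F.map σ) := e.toLinearEquiv.finiteDimensional
  have := NumberField.of_module_finite K F
  have := NumberField.of_module_finite K (F.map σ)
  exact h.of_algHom e.symm.toAlgHom

/-- Inside a common finite Galois extension, being unramified means lying in the fixed fields of the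
inertia elements, and a field containing `F₁` and `F₂` contains their compositum. -/
theorem isUnramifiedIn_sup_of_isUnramifiedIn [Normal K Ω] {F₁ F₂ : IntermediateField K Ω}
    [FiniteDimensional K F₁] [FiniteDimensional K F₂] {v : Ideal (𝓞 K)}
    (h₁ : Algebra.IsUnramifiedIn (𝓞 F₁) v) (h₂ : Algebra.IsUnramifiedIn (𝓞 F₂) v) :
    Algebra.IsUnramifiedIn (𝓞 (F₁ ⊔ F₂ : IntermediateField K Ω)) v := by
  let N : IntermediateField K Ω :=
    IntermediateField.normalClosure K (F₁ ⊔ F₂ : IntermediateField K Ω) Ω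
  have : FiniteDimensional K N := normalClosure.is_finiteDimensional K _ Ω
  have : IsGalois K N := ⟨⟩
  have hN : F₁ ⊔ F₂ ≤ N := IntermediateField.le_normalClosure _
  have key : ∀ F : IntermediateField K Ω, FiniteDimensional K F → ∀ hF : F ≤ N,
      (Algebra.IsUnramifiedIn (𝓞 F) v ↔ ∀ Q : Ideal (𝓞 N), Q.IsPrime → Q.LiesOver v →
        ∀ σ ∈ Q.inertia Gal(N/K), F ≤ (IntermediateField.fixedField (Subgroup.zpowers σ)).map
          N.val) := by
    intro F _ hF
    have := NumberField.of_module_finite K F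
    have := NumberField.of_module_finite K N
    let _ : Algebra F N := (IntermediateField.inclusion hF).toAlgebra
    have : IsScalarTower K F N :=
      IsScalarTower.of_algebraMap_eq' (IntermediateField.inclusion hF).comp_algebraMap.symm
    rw [isUnramifiedIn_iff_inertia (F := F) (N := N)]
    refine forall₅_congr fun Q _ _ σ _ ↦ ⟨fun h x hx ↦ ?_, fun h x ↦ ?_⟩
    · refine ⟨⟨x, hF hx⟩, ?_, rfl⟩
      rintro ⟨τ, hτ⟩
      have : Subgroup.zpowers σ ≤ MulAction.stabilizer Gal(N/K) (⟨x, hF hx⟩ : N) := by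
        rw [Subgroup.zpowers_le]
        exact h ⟨x, hx⟩
      exact this hτ
    · obtain ⟨y, hy, hyx⟩ := h x.2
      have : y = algebraMap F N x := Subtype.ext hyx
      exact this ▸ hy ⟨σ, Subgroup.mem_zpowers σ⟩
  rw [key _ inferInstance hN]
  intro Q hQ hQv σ hσ
  exact sup_le ((key F₁ inferInstance (le_sup_left.trans hN)).1 h₁ Q hQ hQv σ hσ)
    ((key F₂ inferInstance (le_sup_right.trans hN)).1 h₂ Q hQ hQv σ hσ)

theorem UnramifiedOutside.sup [Normal K Ω] {F₁ F₂ : IntermediateField K Ω}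
    [FiniteDimensional K F₁] [FiniteDimensional K F₂] (h₁ : UnramifiedOutside K F₁ T)
    (h₂ : UnramifiedOutside K F₂ T) :
    UnramifiedOutside K (F₁ ⊔ F₂ : IntermediateField K Ω) T :=
  ⟨fun v hv ↦ isUnramifiedIn_sup_of_isUnramifiedIn (h₁.1 v hv) (h₂.1 v hv),
    fun v hv ↦ isUnramifiedIn_infinitePlace_sup (h₁.2 v hv) (h₂.2 v hv)⟩

variable (Ω T) in
theorem directedOn_unramifiedOutside [Normal K Ω] : DirectedOn (· ≤ ·)
    {F : IntermediateField K Ω | FiniteDimensional K F ∧ UnramifiedOutside K F T} := by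
  rintro F₁ ⟨_, h₁⟩ F₂ ⟨_, h₂⟩
  exact ⟨F₁ ⊔ F₂, ⟨inferInstance, h₁.sup h₂⟩, le_sup_left, le_sup_right⟩

theorem exists_unramifiedOutside_of_mem [Normal K Ω] {x : Ω}
    (hx : x ∈ maxUnramifiedOutside K Ω T) :
    ∃ F : IntermediateField K Ω, (FiniteDimensional K F ∧ UnramifiedOutside K F T) ∧ x ∈ F := by
  have hne : Nonempty
      {F : IntermediateField K Ω | FiniteDimensional K F ∧ UnramifiedOutside K F T} :=
    ⟨⊥, inferInstance, .bot K Ω T⟩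
  rw [maxUnramifiedOutside, sSup_eq_iSup', ← SetLike.mem_coe,
    IntermediateField.coe_iSup_of_directed (directedOn_unramifiedOutside Ω T).directed_val,
    Set.mem_iUnion] at hx
  obtain ⟨F, hF⟩ := hx
  exact ⟨F, F.2, hF⟩

/-- A finite subextension of the maximal extension unramified outside `T` is unramified
outside `T`. -/
theorem unramifiedOutside_of_le_max [Normal K Ω] {F : IntermediateField K Ω}
    [FiniteDimensional K F] (hF : F ≤ maxUnramifiedOutside K Ω T) : UnramifiedOutside K F T := by
  -- The family defining the maximal extension is directed, so a primitive element of `F` already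
  -- lies in a single member.
  obtain ⟨α, hα⟩ := Field.exists_primitive_element K F
  obtain ⟨E, ⟨_, hE⟩, hαE⟩ := exists_unramifiedOutside_of_mem (hF α.2)
  refine hE.of_le ?_
  have h := congrArg (IntermediateField.map F.val) hα
  rw [IntermediateField.adjoin_map, ← AlgHom.fieldRange_eq_map, IntermediateField.fieldRange_val,
    Set.image_singleton] at h
  rw [← h, IntermediateField.adjoin_simple_le_iff]
  exact hαE

instance [Normal K Ω] : Normal K (maxUnramifiedOutside K Ω T) := by
  rw [IntermediateField.normal_iff_forall_map_le]
  intro σ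
  rw [IntermediateField.map_le_iff_le_comap]
  refine sSup_le ?_
  rintro F ⟨_, hF⟩
  rw [← IntermediateField.map_le_iff_le_comap]
  have e := F.equivMap σ
  have : FiniteDimensional K (F.map σ) := e.toLinearEquiv.finiteDimensional
  exact le_maxUnramifiedOutside (hF.map σ)

end Sup

/-! ### Bounding the different by the degree -/

section Different

open scoped Pointwise nonZeroDivisors

variable {K L : Type*} [Field K] [Field L] [Algebra K L]

theorem smul_map_algebraMap (σ : Gal(L/K)) (I : Ideal (𝓞 K)) :
    σ • I.map (algebraMap (𝓞 K) (𝓞 L)) = I.map (algebraMap (𝓞 K) (𝓞 L)) := by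
  rw [Ideal.pointwise_smul_def, Ideal.map_map]
  congr 1
  ext x
  exact σ.commutes (x : K)

variable [NumberField L]

theorem smul_dvd_smul_ideal_iff (σ : Gal(L/K)) {I J : Ideal (𝓞 L)} : σ • I ∣ σ • J ↔ I ∣ J := by
  rw [Ideal.dvd_iff_le, Ideal.dvd_iff_le, Ideal.pointwise_smul_le_pointwise_smul_iff]

variable [NumberField K]

theorem mem_differentIdeal_iff {x : 𝓞 L} :
    x ∈ differentIdeal (𝓞 K) (𝓞 L) ↔ ∀ y : L,
      (∀ a : 𝓞 L, Algebra.trace K L (y * a) ∈ (algebraMap (𝓞 K) K).range) →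
        ∃ b : 𝓞 L, (b : L) = x * y := by
  have h := coeSubmodule_differentIdeal (𝓞 K) K (L := L) (𝓞 L)
  have hx : x ∈ differentIdeal (𝓞 K) (𝓞 L) ↔
      (x : L) ∈ IsLocalization.coeSubmodule L (differentIdeal (𝓞 K) (𝓞 L)) := by
    rw [IsLocalization.mem_coeSubmodule]
    exact ⟨fun h ↦ ⟨x, h, rfl⟩, fun ⟨y, hy, hyx⟩ ↦ RingOfIntegers.ext hyx ▸ hy⟩
  rw [hx, h, Submodule.mem_div_iff_forall_mul_mem]
  simp only [Submodule.mem_traceDual, Submodule.mem_one, forall_exists_index,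
    forall_apply_eq_imp_iff, Algebra.traceForm_apply]

theorem smul_differentIdeal (σ : Gal(L/K)) :
    σ • differentIdeal (𝓞 K) (𝓞 L) = differentIdeal (𝓞 K) (𝓞 L) := by
  have key : ∀ (τ : Gal(L/K)) (x : 𝓞 L), x ∈ differentIdeal (𝓞 K) (𝓞 L) →
      τ • x ∈ differentIdeal (𝓞 K) (𝓞 L) := by
    intro τ x hx
    rw [mem_differentIdeal_iff] at hx ⊢
    intro y hy
    obtain ⟨b, hb⟩ := hx (τ⁻¹ y) fun a ↦ by
      have := hy (τ • a)
      rwa [← Algebra.trace_eq_of_algEquiv τ⁻¹, map_mul,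
        show τ⁻¹ ((τ • a : 𝓞 L) : L) = a from τ.symm_apply_apply _] at this
    refine ⟨τ • b, ?_⟩
    have : τ (b : L) = τ x * τ (τ⁻¹ y) := by rw [hb, map_mul]
    rwa [show τ (τ⁻¹ y) = y from τ.apply_symm_apply y] at this
  ext x
  rw [Ideal.mem_pointwise_smul_iff_inv_smul_mem]
  exact ⟨fun h ↦ by simpa using key σ _ h, key σ⁻¹ x⟩

/-- Divisibility says that the trace maps the inverse of `I 𝓞_L` into `𝓞_K`. An element `z` of the
inverse of `I` has trace `n z`, with `n` the degree, so `n` times that inverse is integral. -/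
theorem finrank_mem_of_map_dvd_differentIdeal {I : Ideal (𝓞 K)} (hI : I ≠ ⊥)
    (h : I.map (algebraMap (𝓞 K) (𝓞 L)) ∣ differentIdeal (𝓞 K) (𝓞 L)) :
    (Module.finrank K L : 𝓞 K) ∈ I := by
  have hI' : I.map (algebraMap (𝓞 K) (𝓞 L)) ≠ ⊥ := by
    rwa [Ne, Ideal.map_eq_bot_iff_of_injective (FaithfulSMul.algebraMap_injective _ _)]
  rw [Ideal.dvd_iff_le, differentialIdeal_le_iff (K := K) (L := L) hI'] at h
  have hI₀ : (I : FractionalIdeal (𝓞 K)⁰ K) ≠ 0 := FractionalIdeal.coeIdeal_ne_zero.2 hI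
  suffices hle : FractionalIdeal.spanSingleton (𝓞 K)⁰ (Module.finrank K L : K) ≤ I by
    rw [FractionalIdeal.spanSingleton_le_iff_mem, FractionalIdeal.mem_coeIdeal] at hle
    obtain ⟨x, hx, hxn⟩ := hle
    have : x = (Module.finrank K L : 𝓞 K) := RingOfIntegers.ext (by simpa using! hxn)
    exact this ▸ hx
  rw [← div_le_one₀ (bot_lt_iff_ne_bot.2 hI₀), div_eq_mul_inv,
    FractionalIdeal.spanSingleton_mul_le_iff]
  intro z hz
  rw [FractionalIdeal.mem_inv_iff hI₀] at hz
  have hzL : algebraMap K L z ∈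
      ((I.map (algebraMap (𝓞 K) (𝓞 L)) : Ideal (𝓞 L)) : FractionalIdeal (𝓞 L)⁰ L)⁻¹ := by
    rw [FractionalIdeal.mem_inv_iff (FractionalIdeal.coeIdeal_ne_zero.2 hI')]
    intro y hy
    rw [FractionalIdeal.mem_coeIdeal] at hy
    obtain ⟨y, hy, rfl⟩ := hy
    induction hy using Submodule.span_induction with
    | mem y hy =>
      obtain ⟨x, hx, rfl⟩ := hy
      obtain ⟨c, hc⟩ := (FractionalIdeal.mem_one_iff _).1
        (hz _ (FractionalIdeal.mem_coeIdeal_of_mem _ hx))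
      refine (FractionalIdeal.mem_one_iff _).2 ⟨algebraMap (𝓞 K) (𝓞 L) c, ?_⟩
      rw [← IsScalarTower.algebraMap_apply, ← IsScalarTower.algebraMap_apply,
        IsScalarTower.algebraMap_apply (𝓞 K) K L, IsScalarTower.algebraMap_apply (𝓞 K) K L, hc,
        map_mul]
    | zero => simp
    | add a b _ _ ha hb =>
      rw [map_add, mul_add]
      exact Submodule.add_mem (1 : FractionalIdeal (𝓞 L)⁰ L).coeToSubmodule ha hb
    | smul c a _ ha =>
      have := Submodule.smul_mem (1 : FractionalIdeal (𝓞 L)⁰ L).coeToSubmodule c ha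
      rw [Algebra.smul_def] at this
      rw [smul_eq_mul, map_mul, mul_left_comm]
      exact this
  obtain ⟨c, hc⟩ := Submodule.mem_one.1 (h ⟨_, hzL, rfl⟩)
  refine (FractionalIdeal.mem_one_iff _).2 ⟨c, hc.trans ?_⟩
  change Algebra.trace K L (algebraMap K L z) = _
  rw [Algebra.trace_algebraMap, nsmul_eq_mul]

theorem Ideal.dvd_of_forall_prime_pow_dvd {R : Type*} [CommRing R] [IsDedekindDomain R]
    {I J : Ideal R} (hI : I ≠ ⊥)
    (h : ∀ (P : Ideal R) [P.IsPrime] (m : ℕ), m ≠ 0 → P ^ m ∣ I → P ^ m ∣ J) : I ∣ J := by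
  rw [UniqueFactorizationMonoid.dvd_iff_emultiplicity_le hI]
  intro P hP
  have := Ideal.isPrime_of_prime hP
  rw [emultiplicity_le_emultiplicity_iff]
  intro m
  rcases eq_or_ne m 0 with rfl | hm
  · simp
  · exact h P m hm

/-- The different of a Galois extension unramified outside `S` divides `∏ v ∈ S, v ^ k v` as soon
as the degree is not in `v ^ k v` for `v ∈ S`. -/
theorem differentIdeal_dvd_of_unramifiedOutside [IsGalois K L]
    (S : Finset (HeightOneSpectrum (𝓞 K))) (k : HeightOneSpectrum (𝓞 K) → ℕ)
    (hk : ∀ v, (Module.finrank K L : 𝓞 K) ∉ v.asIdeal ^ k v)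
    (h : ∀ v ∉ S, Algebra.IsUnramifiedIn (𝓞 L) v.asIdeal) :
    differentIdeal (𝓞 K) (𝓞 L) ∣ (∏ v ∈ S, v.asIdeal ^ k v).map (algebraMap (𝓞 K) (𝓞 L)) := by
  have hD : differentIdeal (𝓞 K) (𝓞 L) ≠ ⊥ := differentIdeal_ne_bot
  refine Ideal.dvd_of_forall_prime_pow_dvd hD fun Q _ m hm hQ ↦ ?_
  have hQD : Q ∣ differentIdeal (𝓞 K) (𝓞 L) := (dvd_pow_self Q hm).trans hQ
  have hQ0 : Q ≠ ⊥ := by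
    rintro rfl
    exact hD (zero_dvd_iff.1 hQD)
  let v : HeightOneSpectrum (𝓞 K) := HeightOneSpectrum.under (𝓞 K) ⟨Q, ‹_›, hQ0⟩
  have hQv : Q.LiesOver v.asIdeal := ⟨rfl⟩
  have hv : v ∈ S := by
    by_contra hv
    exact not_dvd_differentIdeal_iff.2 (h v hv Q inferInstance hQv) hQD
  suffices hd : Q ^ m ∣ (v.asIdeal ^ k v).map (algebraMap (𝓞 K) (𝓞 L)) from
    hd.trans (map_dvd (Ideal.mapHom (algebraMap (𝓞 K) (𝓞 L)))
      (Finset.dvd_prod_of_mem (fun v ↦ v.asIdeal ^ k v) hv))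
  -- Both the different and the extended ideal are Galois stable and the group permutes the primes
  -- above `v` transitively. So failure at `Q` makes `v ^ k v` divide the different at every prime,
  -- forcing the degree into `v ^ k v`.
  by_contra hd
  have hvk : v.asIdeal ^ k v ≠ ⊥ := pow_ne_zero _ v.ne_bot
  refine hk v (finrank_mem_of_map_dvd_differentIdeal hvk (Ideal.dvd_of_forall_prime_pow_dvd
    ((Ideal.map_eq_bot_iff_of_injective (FaithfulSMul.algebraMap_injective _ _)).not.2 hvk)
    fun P _ j hj hP ↦ ?_))
  have hPv : P.LiesOver v.asIdeal := by
    have hPle : v.asIdeal ≤ P.under (𝓞 K) := by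
      have := Ideal.dvd_iff_le.1 ((dvd_pow_self P hj).trans hP)
      rw [Ideal.map_pow] at this
      exact Ideal.map_le_iff_le_comap.1 (Ideal.IsPrime.le_of_pow_le this)
    exact ⟨v.isMaximal.eq_of_le (Ideal.IsPrime.under (𝓞 K) P).ne_top hPle⟩
  obtain ⟨σ, rfl⟩ := Ideal.exists_smul_eq_of_isGaloisGroup v.asIdeal Q P Gal(L/K)
  rw [← smul_pow', ← smul_differentIdeal σ, smul_dvd_smul_ideal_iff]
  rw [← smul_pow', ← smul_map_algebraMap σ, smul_dvd_smul_ideal_iff] at hP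
  refine (pow_dvd_pow Q ?_).trans hQ
  by_contra! hlt
  exact hd ((pow_dvd_pow Q hlt.le).trans hP)

/-- By Krull's intersection theorem only 0 lies in all powers of `v`. -/
theorem exists_natCast_notMem_pow (v : HeightOneSpectrum (𝓞 K)) {n : ℕ} (hn : n ≠ 0) :
    ∃ k, (n : 𝓞 K) ∉ v.asIdeal ^ k := by
  by_contra! h
  have : (n : 𝓞 K) ∈ ⨅ i, v.asIdeal ^ i := by simpa using h
  rw [Ideal.iInf_pow_eq_bot_of_isDomain _ v.isPrime.ne_top] at this
  exact hn (by simpa using this)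

end Different

/-! ### Hermite–Minkowski for Galois extensions unramified outside `T` -/

section Hermite

variable {K : Type*} [Field K] [NumberField K] {T : Set (NFPlace K)}

/-- The discriminants of the Galois extensions of `K` of given degree that are unramified outside
a finite set are bounded. -/
theorem exists_natAbs_discr_le (hT : T.Finite) {n : ℕ} (hn : n ≠ 0) :
    ∃ B : ℕ, ∀ (L : Type*) [Field L] [NumberField L] [Algebra K L] [IsGalois K L],
      Module.finrank K L = n → UnramifiedOutside K L T → (discr L).natAbs ≤ B := by
  choose k hk using fun v : HeightOneSpectrum (𝓞 K) ↦ exists_natCast_notMem_pow v hn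
  let S : Finset (HeightOneSpectrum (𝓞 K)) := (hT.preimage Sum.inl_injective.injOn).toFinset
  let J : Ideal (𝓞 K) := ∏ v ∈ S, v.asIdeal ^ k v
  have hJ : J ≠ ⊥ := Finset.prod_ne_zero_iff.2 fun v _ ↦ pow_ne_zero _ v.ne_bot
  -- The first factor is the norm of `J 𝓞_L`, which bounds the norm of the different; the second
  -- comes from the discriminant formula in the tower over `ℚ`.
  refine ⟨Ideal.absNorm J ^ n * (discr K).natAbs ^ n, fun L _ _ _ _ hL h ↦ ?_⟩
  rw [natAbs_discr_eq_absNorm_differentIdeal_mul_natAbs_discr_pow K (𝓞 K) L (𝓞 L), hL]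
  refine Nat.mul_le_mul_right _ (Nat.le_of_dvd (Nat.pos_of_ne_zero ?_) ?_)
  · exact pow_ne_zero _ (Ideal.absNorm_eq_zero_iff.not.2 hJ)
  · have := differentIdeal_dvd_of_unramifiedOutside (L := L) S k (by rwa [hL])
      fun v hv ↦ h.1 v (by simpa [S] using hv)
    have := map_dvd Ideal.absNorm this
    rwa [Ideal.absNorm_algebraMap, ← IsFractionRing.finrank_eq (𝓞 K) K (𝓞 L) L, hL] at this

/-- **Hermite–Minkowski**: there are only finitely many Galois extensions of `K` in `Ω` of bounded
degree unramified outside a finite set. -/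
theorem finite_setOf_unramifiedOutside (Ω : Type*) [Field Ω] [Algebra K Ω] (hT : T.Finite)
    (n : ℕ) : {F : IntermediateField K Ω | FiniteDimensional K F ∧ IsGalois K F ∧
      Module.finrank K F ≤ n ∧ UnramifiedOutside K F T}.Finite := by
  have : CharZero Ω := charZero_of_injective_algebraMap (algebraMap K Ω).injective
  have key : ∀ d : ℕ, d ≠ 0 → {F : IntermediateField K Ω | FiniteDimensional K F ∧ IsGalois K F ∧
      Module.finrank K F = d ∧ UnramifiedOutside K F T}.Finite := by
    intro d hd
    obtain ⟨B, hB⟩ := exists_natAbs_discr_le hT hd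
    have hfin := (NumberField.finite_of_discr_bdd Ω B).image Subtype.val
    refine Set.Finite.of_finite_image (f := fun F ↦ F.restrictScalars ℚ) (hfin.subset ?_)
      (IntermediateField.restrictScalars_injective ℚ).injOn
    rintro _ ⟨F, ⟨_, _, hF, h⟩, rfl⟩
    have : NumberField F := NumberField.of_module_finite K F
    have hfd : FiniteDimensional ℚ (F.restrictScalars ℚ) :=
      inferInstanceAs (FiniteDimensional ℚ F)
    refine ⟨⟨F.restrictScalars ℚ, hfd⟩, ?_, rfl⟩
    have := hB F hF h
    change |discr F| ≤ B
    rw [Int.abs_eq_natAbs]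
    exact_mod_cast this
  refine ((Finset.Icc 1 n).finite_toSet.biUnion fun d hd ↦ key d ?_).subset ?_
  · have := Finset.mem_Icc.1 (Finset.mem_coe.1 hd)
    omega
  · rintro F ⟨_, hG, hF, h⟩
    simp only [Set.mem_iUnion]
    exact ⟨_, Finset.mem_coe.2 (Finset.mem_Icc.2 ⟨Module.finrank_pos, hF⟩), ‹_›, hG, rfl, h⟩

end Hermite

/-! ### Continuity as openness of the kernel -/

section DiscreteHom

variable {H A : Type*} [Group H] [TopologicalSpace H] [IsTopologicalGroup H] [Group A]

/-- Continuous homomorphisms to a discrete group are the homomorphisms with open kernel. -/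
noncomputable def discreteHomEquiv :
    DiscreteHom H A ≃ {φ : H →* A | IsOpen (φ.ker : Set H)} where
  toFun f :=
    letI : TopologicalSpace A := ⊥
    haveI : DiscreteTopology A := ⟨rfl⟩
    ⟨f.toMonoidHom, (isOpen_discrete ({1} : Set A)).preimage f.continuous_toFun⟩
  invFun φ :=
    letI : TopologicalSpace A := ⊥
    haveI : DiscreteTopology A := ⟨rfl⟩
    { φ.1 with
      continuous_toFun := by
        refine continuous_of_continuousAt_one φ.1 ?_
        rw [ContinuousAt, map_one, nhds_discrete A, Filter.tendsto_pure]
        exact φ.2.mem_nhds (one_mem φ.1.ker) }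
  left_inv _ := rfl
  right_inv _ := rfl

end DiscreteHom

/-! ### Galois groups of subextensions and the Krull topology -/

section Krull

variable {K Ω : Type*} [Field K] [Field Ω] [Algebra K Ω]

theorem range_restrictScalarsHom {L : IntermediateField K Ω} :
    (AlgEquiv.restrictScalarsHom K : Gal(Ω/L) →* Gal(Ω/K)).range = L.fixingSubgroup := by
  ext σ
  rw [IntermediateField.mem_fixingSubgroup_iff]
  constructor
  · rintro ⟨τ, rfl⟩ x hx
    exact τ.commutes ⟨x, hx⟩
  · intro h
    exact ⟨AlgEquiv.ofRingEquiv (f := σ.toRingEquiv) fun x ↦ h x x.2, rfl⟩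

variable [IsGalois K Ω]

/-- Homomorphisms from `Gal(U/K)` with open kernel, for `U` a normal subextension of `Ω/K`, are the
homomorphisms from `Gal(Ω/K)` with open kernel that are trivial on `Gal(Ω/U)`. -/
noncomputable def openKerHomEquiv (U : IntermediateField K Ω) [Normal K U] (A : Type*) [Group A] :
    {φ : Gal(U/K) →* A | IsOpen (φ.ker : Set Gal(U/K))} ≃
      {φ : Gal(Ω/K) →* A | IsOpen (φ.ker : Set Gal(Ω/K)) ∧ U.fixingSubgroup ≤ φ.ker} where
  toFun φ := ⟨φ.1.comp (AlgEquiv.restrictNormalHom U),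
    φ.2.preimage (InfiniteGalois.restrictNormalHom_continuous U), fun σ hσ ↦ by
      rw [← U.restrictNormalHom_ker] at hσ
      rw [MonoidHom.mem_ker, MonoidHom.comp_apply, MonoidHom.mem_ker.1 hσ, map_one]⟩
  invFun φ := ⟨(AlgEquiv.restrictNormalHom U).liftOfSurjective
      (AlgEquiv.restrictNormalHom_surjective Ω) ⟨φ.1, by
        rw [U.restrictNormalHom_ker]; exact φ.2.2⟩, by
    -- Restriction is a closed continuous surjection, by compactness, so openness of a kernel can be
    -- tested upstairs.
    have hq : Topology.IsQuotientMap (AlgEquiv.restrictNormalHom (F := K) (K₁ := Ω) U) :=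
      (InfiniteGalois.restrictNormalHom_continuous U).isClosedMap.isQuotientMap
        (InfiniteGalois.restrictNormalHom_continuous U) (AlgEquiv.restrictNormalHom_surjective Ω)
    rw [Set.mem_ofPred_eq, ← hq.isOpen_preimage]
    convert φ.2.1 using 1
    ext σ
    simp [MonoidHom.liftOfRightInverse_comp_apply, MonoidHom.mem_ker]⟩
  left_inv φ := by
    ext σ
    obtain ⟨σ, rfl⟩ := AlgEquiv.restrictNormalHom_surjective (F := K) (K₁ := U) Ω σ
    simp [MonoidHom.liftOfRightInverse_comp_apply]
  right_inv φ := by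
    ext σ
    simp

section FixedField

variable {B : Type*} [Group B] {φ : Gal(Ω/K) →* B}

theorem fixingSubgroup_fixedField_ker (hφ : IsOpen (φ.ker : Set Gal(Ω/K))) :
    (IntermediateField.fixedField φ.ker).fixingSubgroup = φ.ker :=
  InfiniteGalois.fixingSubgroup_fixedField ⟨φ.ker, Subgroup.isClosed_of_isOpen _ hφ⟩

theorem finiteDimensional_and_isGalois_fixedField_ker (hφ : IsOpen (φ.ker : Set Gal(Ω/K))) :
    FiniteDimensional K (IntermediateField.fixedField φ.ker) ∧
      IsGalois K (IntermediateField.fixedField φ.ker) := by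
  rw [← InfiniteGalois.isOpen_and_normal_iff_finite_and_isGalois,
    fixingSubgroup_fixedField_ker hφ]
  exact ⟨hφ, inferInstance⟩

theorem exists_injective_gal_fixedField_ker (hφ : IsOpen (φ.ker : Set Gal(Ω/K))) :
    ∃ ψ : Gal(IntermediateField.fixedField φ.ker/K) →* B, Function.Injective ψ := by
  let C : ClosedSubgroup Gal(Ω/K) := ⟨φ.ker, Subgroup.isClosed_of_isOpen _ hφ⟩
  have : C.Normal := inferInstanceAs φ.ker.Normal
  exact ⟨(QuotientGroup.kerLift φ).comp (InfiniteGalois.normalAutEquivQuotient C).symm.toMonoidHom,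
    (QuotientGroup.kerLift_injective φ).comp (MulEquiv.injective _)⟩

theorem fixedField_ker_le {U : IntermediateField K Ω} (hU : U.fixingSubgroup ≤ φ.ker) :
    IntermediateField.fixedField φ.ker ≤ U := by
  rw [← InfiniteGalois.fixedField_fixingSubgroup U]
  exact IntermediateField.fixedField_antitone hU

end FixedField

variable {L : IntermediateField K Ω}

/-- Adjoining to `L` a `K`-basis of a finite `E/K` gives a finite extension of `L`, and whatever
fixes it fixes `E`. -/
theorem continuous_restrictScalarsHom :
    Continuous (AlgEquiv.restrictScalarsHom K : Gal(Ω/L) →* Gal(Ω/K)) := by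
  refine continuous_of_continuousAt_one _ (continuousAt_def.2 fun s hs ↦ ?_)
  rw [map_one, krullTopology_mem_nhds_one_iff] at hs
  obtain ⟨E, _, hE⟩ := hs
  let b := Module.finBasis K E
  have : FiniteDimensional L (IntermediateField.adjoin L (Set.range fun i ↦ (b i : Ω))) :=
    IntermediateField.finiteDimensional_adjoin fun x _ ↦
      (Algebra.IsIntegral.isIntegral (R := K) x).tower_top
  rw [krullTopology_mem_nhds_one_iff]
  refine ⟨_, this, fun τ hτ ↦ hE ?_⟩
  rw [SetLike.mem_coe, IntermediateField.mem_fixingSubgroup_iff] at hτ ⊢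
  intro x hx
  have key : (AlgEquiv.restrictScalars K τ).toLinearMap ∘ₗ E.val.toLinearMap =
      E.val.toLinearMap := b.ext fun i ↦ hτ _ (IntermediateField.subset_adjoin _ _ ⟨i, rfl⟩)
  exact LinearMap.congr_fun key ⟨x, hx⟩

end Krull

/-! ### Homomorphisms unramified outside `T` and their finiteness -/

section HomSet

variable (K Ω : Type*) [Field K] [Field Ω] [Algebra K Ω] (T : Set (NFPlace K)) (A : Type*) [Group A]

/-- The homomorphisms from `Gal(Ω/K)` to `A` with open kernel that are trivial on the automorphisms
fixing the maximal extension of `K` unramified outside `T`. -/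
def homUnramifiedOutside : Set (Gal(Ω/K) →* A) :=
  {φ | IsOpen (φ.ker : Set Gal(Ω/K)) ∧ (maxUnramifiedOutside K Ω T).fixingSubgroup ≤ φ.ker}

variable [NumberField K] [IsGalois K Ω]

/-- Continuous homomorphisms from `G_K^T`, seen as homomorphisms from `Gal(Ω/K)`. -/
noncomputable def discreteHomEquivHomUnramifiedOutside :
    DiscreteHom (GaloisGroupOutside K Ω T) A ≃ homUnramifiedOutside K Ω T A :=
  discreteHomEquiv.trans (openKerHomEquiv (maxUnramifiedOutside K Ω T) A)

variable {K T}

/-- The kernel of each such homomorphism cuts out a Galois extension of degree at most `|A|`, one of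
finitely many. All homomorphisms therefore factor through the finite Galois group of the compositum
`M`. -/
theorem finite_homUnramifiedOutside [Finite A] (hT : T.Finite) :
    (homUnramifiedOutside K Ω T A).Finite := by
  let 𝓕 := {F : IntermediateField K Ω | FiniteDimensional K F ∧ IsGalois K F ∧
    Module.finrank K F ≤ Nat.card A ∧ UnramifiedOutside K F T}
  have : Finite 𝓕 := finite_setOf_unramifiedOutside Ω hT (Nat.card A)
  have (F : 𝓕) : FiniteDimensional K F.1 := F.2.1
  let M : IntermediateField K Ω := ⨆ F : 𝓕, F.1
  have : Finite (Gal(Ω/K) ⧸ M.fixingSubgroup) :=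
    Subgroup.quotient_finite_of_isOpen _ M.fixingSubgroup_isOpen
  have hker : ∀ φ ∈ homUnramifiedOutside K Ω T A, M.fixingSubgroup ≤ φ.ker := by
    rintro φ ⟨hφ, hU⟩
    rw [← fixingSubgroup_fixedField_ker hφ]
    obtain ⟨h₁, h₂⟩ := finiteDimensional_and_isGalois_fixedField_ker hφ
    refine IntermediateField.fixingSubgroup_antitone (le_iSup (fun F : 𝓕 ↦ F.1)
      ⟨IntermediateField.fixedField φ.ker, h₁, h₂, ?_,
        unramifiedOutside_of_le_max (fixedField_ker_le hU)⟩)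
    rw [IntermediateField.finrank_eq_fixingSubgroup_index, fixingSubgroup_fixedField_ker hφ,
      Subgroup.index_ker]
    exact Nat.card_le_card_of_injective _ Subtype.val_injective
  refine Set.Finite.of_injOn (f := fun φ ↦ (fun q ↦ φ q.out : Gal(Ω/K) ⧸ M.fixingSubgroup → A))
    (t := Set.univ) (Set.mapsTo_univ _ _) ?_ Set.finite_univ
  intro φ hφ ψ hψ h
  have key : ∀ χ ∈ homUnramifiedOutside K Ω T A, ∀ σ : Gal(Ω/K),
      χ (σ : Gal(Ω/K) ⧸ M.fixingSubgroup).out = χ σ := by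
    intro χ hχ σ
    rw [← inv_mul_eq_one, ← map_inv, ← map_mul]
    exact hker χ hχ (QuotientGroup.eq.1 (Quotient.out_eq' _))
  ext σ
  rw [← key φ hφ, ← key ψ hψ]
  exact congrFun h σ

theorem finite_discreteHom_galoisGroupOutside [Finite A] (hT : T.Finite) :
    Finite (DiscreteHom (GaloisGroupOutside K Ω T) A) := by
  have : Finite (homUnramifiedOutside K Ω T A) := finite_homUnramifiedOutside Ω A hT
  exact Finite.of_equiv _ (discreteHomEquivHomUnramifiedOutside K Ω T A).symm

end HomSet

/-! ### The numerical inequality and the group-theoretic count -/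

section Counting

/-- For `1 ≤ g ≤ b`, one has `b ^ (g - 1) ≤ g ^ b`. -/
theorem Nat.pow_sub_one_le_pow {g b : ℕ} (hg : 1 ≤ g) (hgb : g ≤ b) : b ^ (g - 1) ≤ g ^ b := by
  obtain ⟨t, rfl⟩ := Nat.exists_eq_add_of_le' hg
  rw [Nat.add_sub_cancel]
  rcases Nat.eq_zero_or_pos t with rfl | ht
  · simp
  have ht' : (0 : ℝ) < t := by exact_mod_cast ht
  have hp : (1 : ℝ) ≤ b / t := by
    rw [one_le_div ht']
    exact_mod_cast (Nat.le_succ t).trans hgb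
  -- Bernoulli with exponent `b / t` gives `1 + b ≤ (1 + t) ^ (b / t)`, where `t = g - 1`; then
  -- raise to the power `t`.
  have h := one_add_mul_self_le_rpow_one_add (s := (t : ℝ)) (by linarith) hp
  rw [div_mul_cancel₀ _ ht'.ne'] at h
  have h' : (b : ℝ) ^ t ≤ ((1 + t : ℝ) ^ ((b : ℝ) / t)) ^ t := by
    gcongr
    linarith
  rw [← Real.rpow_natCast, ← Real.rpow_natCast, ← Real.rpow_mul (by positivity),
    div_mul_cancel₀ _ ht'.ne', Real.rpow_natCast, Real.rpow_natCast, add_comm] at h'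
  exact_mod_cast h'

/-- Homomorphisms `φ : Γ → B` that agree with `φ₀` modulo a normal subgroup `A` are determined by
the homomorphism `φ φ₀⁻¹` to `A` on a subgroup on which `φ₀` centralizes `A`, and by the values of
`φ φ₀⁻¹` at representatives of the nontrivial cosets. -/
theorem ncard_le_of_centralizer {Γ M B : Type*} [Group Γ] [Group M] [Group B] (A : Subgroup B)
    [Finite A] (φ₀ : Γ →* B) (ι : M →* Γ) [ι.range.FiniteIndex]
    (hι : ∀ x, φ₀ (ι x) ∈ Subgroup.centralizer (A : Set B)) (X : Set (Γ →* B))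
    (hX : ∀ φ ∈ X, ∀ γ, φ γ * (φ₀ γ)⁻¹ ∈ A) (Y : Set (M →* A)) (hY : Y.Finite)
    (hXY : ∀ φ ∈ X, ∀ ψ : M →* A, (∀ x, (ψ x : B) = φ (ι x) * (φ₀ (ι x))⁻¹) → ψ ∈ Y) :
    X.ncard ≤ Nat.card A ^ (ι.range.index - 1) * Y.ncard := by
  have := hY.to_subtype
  have : Finite (Γ ⧸ ι.range) := Subgroup.finite_quotient_of_finiteIndex
  -- The trivial coset is already controlled by `ψ`; omitting it gives the exponent `index - 1`,
  -- without which the bound `g ^ b` would fail for `g = 1`.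
  let Q := {q : Γ ⧸ ι.range // q ≠ (1 : Γ)}
  let ψ (φ : X) : M →* A := MonoidHom.mk' (fun x ↦ ⟨φ.1 (ι x) * (φ₀ (ι x))⁻¹, hX _ φ.2 _⟩) <| by
    intro x y
    ext
    simp only [map_mul, mul_inv_rev, Subgroup.coe_mul]
    -- Multiplicativity of `φ φ₀⁻¹` needs `φ₀ (ι x)` to commute with the element of `A` attached to
    -- `y`.
    have := Subgroup.mem_centralizer_iff.1 (inv_mem (hι x)) _ (hX _ φ.2 (ι y))
    simp only [← mul_assoc] at this ⊢
    rw [mul_assoc (φ.1 (ι x)), mul_assoc (φ.1 (ι x)), this]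
    simp only [← mul_assoc]
  let F (φ : X) : (Q → A) × Y :=
    (fun q ↦ ⟨φ.1 q.1.out * (φ₀ q.1.out)⁻¹, hX _ φ.2 _⟩, ⟨ψ φ, hXY _ φ.2 _ fun _ ↦ rfl⟩)
  have hF : Function.Injective F := by
    intro φ φ' h
    have h₁ : ∀ q : Γ ⧸ ι.range, q ≠ (1 : Γ) → φ.1 q.out = φ'.1 q.out := fun q hq ↦
      mul_right_cancel (congrArg Subtype.val (congrFun (congrArg Prod.fst h) ⟨q, hq⟩))
    have h₂ : ∀ x, φ.1 (ι x) = φ'.1 (ι x) := fun x ↦ mul_right_cancel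
      (congrArg Subtype.val (DFunLike.congr_fun (congrArg Subtype.val (congrArg Prod.snd h)) x))
    ext γ
    by_cases hγ : (γ : Γ ⧸ ι.range) = (1 : Γ)
    · obtain ⟨x, hx⟩ := QuotientGroup.eq.1 hγ.symm
      rw [inv_one, one_mul] at hx
      rw [← hx, h₂]
    · obtain ⟨x, hx⟩ := QuotientGroup.eq.1 (Quotient.out_eq' (γ : Γ ⧸ ι.range))
      have : γ = (γ : Γ ⧸ ι.range).out * ι x := by rw [hx, mul_inv_cancel_left]
      rw [this, map_mul, map_mul, h₁ _ hγ, h₂]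
  have hQ : Nat.card Q = ι.range.index - 1 := by
    classical
    have := Fintype.ofFinite (Γ ⧸ ι.range)
    rw [Subgroup.index, Nat.card_eq_fintype_card, Nat.card_eq_fintype_card]
    exact Set.card_ne_eq _
  have := Nat.card_le_card_of_injective F hF
  rwa [Nat.card_prod, Nat.card_fun, hQ] at this

end Counting

/-! ### Passing from `K` and `T` to `L` and `T(L)` -/

section BaseChange

variable {K Ω : Type*} [Field K] [NumberField K] [Field Ω] [Algebra K Ω]

theorem finite_placesAbove {T : Set (NFPlace K)} (hT : T.Finite) (L : Type*) [Field L]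
    [NumberField L] [Algebra K L] : (placesAbove T L).Finite := by
  have : placesAbove T L = ⋃ v ∈ T, {w | PlaceAbove K L w v} := by
    ext
    simp [placesAbove]
  rw [this]
  refine hT.biUnion ?_
  rintro (v | v) -
  · have hinj : Set.InjOn (fun w : HeightOneSpectrum (𝓞 L) ↦ w.asIdeal)
        {w | w.asIdeal.LiesOver v.asIdeal} := fun w _ w' _ h ↦ HeightOneSpectrum.ext h
    have hfin : {w : HeightOneSpectrum (𝓞 L) | w.asIdeal.LiesOver v.asIdeal}.Finite := by
      have := v.isMaximal
      refine Set.Finite.of_finite_image ((IsDedekindDomain.primesOver_finite v.asIdeal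
        (𝓞 L)).subset ?_) hinj
      rintro _ ⟨w, hw, rfl⟩
      exact ⟨w.isPrime, hw⟩
    refine (hfin.image Sum.inl).subset ?_
    rintro (w | w) hw
    · exact ⟨w, hw, rfl⟩
    · exact hw.elim
  · refine ((Set.toFinite {w : InfinitePlace L | w.comap (algebraMap K L) = v}).image
      Sum.inr).subset ?_
    rintro (w | w) hw
    · exact hw.elim
    · exact ⟨w, hw, rfl⟩

/-- If `L/K` is unramified outside `T`, the maximal extension of `K` unramified outside `T` is
contained in that of `L` unramified outside `T(L)`. -/
theorem mem_maxUnramifiedOutside_placesAbove [Normal K Ω] {T : Set (NFPlace K)}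
    {L : IntermediateField K Ω} [FiniteDimensional K L] (hL : UnramifiedOutside K L T) {x : Ω}
    (hx : x ∈ maxUnramifiedOutside K Ω T) : x ∈ maxUnramifiedOutside L Ω (placesAbove T L) := by
  obtain ⟨F, ⟨_, hF⟩, hxF⟩ := exists_unramifiedOutside_of_mem hx
  have hE := hL.sup hF
  let E := IntermediateField.extendScalars (le_sup_left : L ≤ L ⊔ F)
  let e : E →ₐ[K] (L ⊔ F : IntermediateField K Ω) :=
    { toFun := fun y ↦ ⟨y.1, y.2⟩
      map_one' := rfl
      map_mul' := fun _ _ ↦ rfl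
      map_zero' := rfl
      map_add' := fun _ _ ↦ rfl
      commutes' := fun _ ↦ rfl }
  have he : Function.Injective e := fun y z h ↦ Subtype.ext (congrArg (fun t ↦ t.1) h)
  have : FiniteDimensional K E := .of_injective e.toLinearMap he
  have : FiniteDimensional L E := .right K L E
  have := NumberField.of_module_finite K L
  have := NumberField.of_module_finite K E
  have := NumberField.of_module_finite K (L ⊔ F : IntermediateField K Ω)
  exact le_maxUnramifiedOutside (hE.of_algHom e).tower_top (F := E) (le_sup_right (a := L) hxF)

end BaseChange

/-! ### Fibres of composition with a quotient map -/

section Fibre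

variable {K Ω : Type*} [Field K] [Field Ω] [Algebra K Ω] {T : Set (NFPlace K)}
  {B : Type*} [Group B]

theorem comp_mem_homUnramifiedOutside {C : Type*} [Group C] {φ : Gal(Ω/K) →* B}
    (hφ : φ ∈ homUnramifiedOutside K Ω T B) (π : B →* C) :
    π.comp φ ∈ homUnramifiedOutside K Ω T C := by
  have hle : φ.ker ≤ (π.comp φ).ker := fun σ hσ ↦ by
    rw [MonoidHom.mem_ker, MonoidHom.comp_apply, MonoidHom.mem_ker.1 hσ, map_one]
  exact ⟨Subgroup.isOpen_mono hle hφ.1, hφ.2.trans hle⟩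

theorem one_mem_homUnramifiedOutside : (1 : Gal(Ω/K) →* B) ∈ homUnramifiedOutside K Ω T B := by
  constructor <;> simp

/-- The homomorphisms that agree with `φ₀` modulo `A`. -/
def homFibre (T : Set (NFPlace K)) (A : Subgroup B) (φ₀ : Gal(Ω/K) →* B) :
    Set (Gal(Ω/K) →* B) :=
  {φ | φ ∈ homUnramifiedOutside K Ω T B ∧ ∀ σ, φ σ * (φ₀ σ)⁻¹ ∈ A}

variable [NumberField K] [IsGalois K Ω]

theorem ncard_homFibre_le [Finite B] (hT : T.Finite) (A : Subgroup B) {φ₀ : Gal(Ω/K) →* B}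
    (h₀ : φ₀ ∈ homUnramifiedOutside K Ω T B) {L : IntermediateField K Ω} [FiniteDimensional K L]
    [IsGalois K L] (hL : UnramifiedOutside K L T)
    (hA : ∀ σ ∈ L.fixingSubgroup, φ₀ σ ∈ Subgroup.centralizer (A : Set B))
    (hcard : Nat.card Gal(L/K) ≤ Nat.card B) :
    (homFibre T A φ₀).ncard ≤ Nat.card Gal(L/K) ^ Nat.card B *
      Nat.card (DiscreteHom (GaloisGroupOutside L Ω (placesAbove T L)) A) := by
  have := NumberField.of_module_finite K L
  let ι : Gal(Ω/L) →* Gal(Ω/K) := AlgEquiv.restrictScalarsHom K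
  have hι : ι.range = L.fixingSubgroup := range_restrictScalarsHom
  have hindex : ι.range.index = Nat.card Gal(L/K) := by
    rw [hι, ← IntermediateField.finrank_eq_fixingSubgroup_index, IsGalois.card_aut_eq_finrank]
  have : ι.range.FiniteIndex := ⟨by rw [hindex]; exact Nat.card_pos.ne'⟩
  have hmem (τ : Gal(Ω/L)) : ι τ ∈ L.fixingSubgroup := hι ▸ ⟨τ, rfl⟩
  have hY := finite_homUnramifiedOutside Ω A (finite_placesAbove hT L)
  have key := ncard_le_of_centralizer A φ₀ ι (fun τ ↦ hA _ (hmem τ)) (homFibre T A φ₀)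
    (fun φ hφ ↦ hφ.2) (homUnramifiedOutside L Ω (placesAbove T L) A) hY (by
      intro φ hφ ψ hψ
      -- The twist is trivial wherever `φ` and `φ₀` both are, so it inherits from them the open
      -- kernel and the ramification condition.
      have hle : (φ.ker ⊓ φ₀.ker).comap ι ≤ ψ.ker := by
        rintro τ ⟨h₁, h₂⟩
        ext
        rw [hψ, MonoidHom.mem_ker.1 h₁, MonoidHom.mem_ker.1 h₂]
        simp
      refine ⟨Subgroup.isOpen_mono hle
        ((hφ.1.1.inter h₀.1).preimage continuous_restrictScalarsHom), le_trans ?_ hle⟩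
      intro τ hτ
      have : ι τ ∈ (maxUnramifiedOutside K Ω T).fixingSubgroup := by
        rw [IntermediateField.mem_fixingSubgroup_iff] at hτ ⊢
        exact fun x hx ↦ hτ x (mem_maxUnramifiedOutside_placesAbove hL hx)
      exact ⟨hφ.1.2 this, h₀.2 this⟩)
  rw [Nat.card_congr (discreteHomEquivHomUnramifiedOutside L Ω (placesAbove T L) A),
    Nat.card_coe_set_eq]
  refine key.trans (Nat.mul_le_mul_right _ ?_)
  rw [hindex]
  exact (Nat.pow_le_pow_left (Nat.card_le_card_of_injective _ A.subtype_injective) _).trans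
    (Nat.pow_sub_one_le_pow Nat.card_pos hcard)

/-- Take `φ₀` with a largest fibre. If `π` is trivial there is a single fibre, and picking `1` in it
is what later makes the top field equal to `K`. -/
theorem exists_ncard_le_homFibre_mul [Finite B] (hT : T.Finite) {B' : Type*} [Group B'] [Finite B']
    (π : B →* B') : ∃ φ₀ ∈ homUnramifiedOutside K Ω T B, (π.ker = ⊤ → φ₀ = 1) ∧
      (homUnramifiedOutside K Ω T B).ncard ≤
        (homFibre T π.ker φ₀).ncard * (homUnramifiedOutside K Ω T B').ncard := by
  classical
  have hB := finite_homUnramifiedOutside Ω B hT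
  have hB' := finite_homUnramifiedOutside Ω B' hT
  by_cases hπ : π.ker = ⊤
  · refine ⟨1, one_mem_homUnramifiedOutside, fun _ ↦ rfl, ?_⟩
    have : homFibre T π.ker 1 = homUnramifiedOutside K Ω T B := by
      ext
      simp [homFibre, hπ]
    rw [this]
    exact Nat.le_mul_of_pos_right _ ((Set.ncard_pos hB').2 ⟨1, one_mem_homUnramifiedOutside⟩)
  · obtain ⟨φ₀, h₀, hmax⟩ := hB.exists_maximalFor (fun φ ↦ (homFibre T π.ker φ).ncard) _
      ⟨1, one_mem_homUnramifiedOutside⟩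
    refine ⟨φ₀, h₀, fun h ↦ (hπ h).elim, ?_⟩
    rw [Set.ncard_eq_toFinset_card _ hB, Set.ncard_eq_toFinset_card _ hB']
    refine (Finset.card_le_mul_card_image_of_maps_to (f := π.comp) (t := hB'.toFinset)
      (fun φ hφ ↦ ?_) _ fun φ' _ ↦ ?_)
    · rw [Set.Finite.mem_toFinset] at *
      exact comp_mem_homUnramifiedOutside hφ π
    · rcases Finset.eq_empty_or_nonempty {φ ∈ hB.toFinset | π.comp φ = φ'} with h | ⟨φ₁, h₁⟩
      · rw [h]
        simp
      · rw [Finset.mem_filter, Set.Finite.mem_toFinset] at h₁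
        have hle : (homFibre T π.ker φ₁).ncard ≤ (homFibre T π.ker φ₀).ncard :=
          (le_total _ _).elim id fun h ↦ hmax h₁.1 h
        refine le_trans ?_ hle
        rw [← Set.ncard_coe_finset]
        refine Set.ncard_le_ncard (fun φ hφ ↦ ?_) (hB.subset fun φ hφ ↦ hφ.1)
        rw [Finset.mem_coe, Finset.mem_filter, Set.Finite.mem_toFinset] at hφ
        refine ⟨hφ.1, fun σ ↦ ?_⟩
        have : π (φ σ) = π (φ₁ σ) := DFunLike.congr_fun (hφ.2.trans h₁.2.symm) σ
        rw [MonoidHom.mem_ker, map_mul, map_inv, this, mul_inv_cancel]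

end Fibre

/-! ### One step of the normal series, and the product -/

section NormalSeriesStep

variable {G : Type*} [Group G] {m : ℕ} (S : NormalSeries G m)

/-- The projection `G/G_{i-1} → G/G_i`. -/
def NormalSeries.proj (i : Fin m) : S.Quot i →* G ⧸ S.term i.succ :=
  QuotientGroup.map _ _ (MonoidHom.id G) (by
    rw [Subgroup.comap_id]
    exact S.mono i.castSucc_le_succ)

theorem NormalSeries.ker_proj (i : Fin m) : (S.proj i).ker = S.factor i := by
  ext x
  obtain ⟨g, rfl⟩ := QuotientGroup.mk_surjective x
  rw [MonoidHom.mem_ker, NormalSeries.proj, NormalSeries.factor, QuotientGroup.map_mk,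
    QuotientGroup.eq_one_iff, Subgroup.mem_map]
  constructor
  · exact fun h ↦ ⟨g, h, rfl⟩
  · rintro ⟨h, hh, hhg⟩
    have := S.mono i.castSucc_le_succ (QuotientGroup.eq.1 hhg)
    simpa using mul_mem hh this

theorem NormalSeries.factor_eq_top {i : Fin m} (hi : (i : ℕ) + 1 = m) : S.factor i = ⊤ := by
  have : i.succ = Fin.last m := Fin.ext hi
  rw [NormalSeries.factor, this, S.term_last, ← MonoidHom.range_eq_map,
    MonoidHom.range_eq_top.2 (QuotientGroup.mk'_surjective _)]

theorem Fin.le_prod_of_le_mul {m : ℕ} (h : Fin (m + 1) → ℕ) (c : Fin m → ℕ)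
    (hc : ∀ i, h i.castSucc ≤ c i * h i.succ) (hlast : h (Fin.last m) ≤ 1) :
    h 0 ≤ ∏ i, c i := by
  induction m with
  | zero => simpa using hlast
  | succ m ih =>
    rw [Fin.prod_univ_succ]
    refine (hc 0).trans (Nat.mul_le_mul_left _ ?_)
    exact ih (fun j ↦ h j.succ) (fun i ↦ c i.succ) (fun i ↦ hc i.succ) hlast

variable {K Ω : Type*} [Field K] [Field Ω] [Algebra K Ω] {T : Set (NFPlace K)}

theorem NormalSeries.ncard_last_le_one :
    (homUnramifiedOutside K Ω T (G ⧸ S.term (Fin.last m))).ncard ≤ 1 := by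
  have : Subsingleton (G ⧸ S.term (Fin.last m)) := by
    rw [QuotientGroup.subsingleton_iff, S.term_last]
  have : Subsingleton (Gal(Ω/K) →* G ⧸ S.term (Fin.last m)) :=
    ⟨fun _ _ ↦ MonoidHom.ext fun _ ↦ Subsingleton.elim _ _⟩
  exact Set.ncard_le_one_of_subsingleton _

variable [NumberField K] [IsGalois K Ω] [Finite G]

/-- The field is the fixed field of the kernel of `χ`, the reduction of `φ₀` modulo the centralizer:
the automorphisms fixing it are precisely those that `φ₀` sends into the centralizer. -/
theorem NormalSeries.exists_field_step (hT : T.Finite) (i : Fin m) :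
    ∃ L : IntermediateField K Ω,
      (FiniteDimensional K L ∧ IsGalois K L ∧ UnramifiedOutside K L T) ∧
      ((i : ℕ) + 1 = m → L = ⊥) ∧
      (∃ φ : Gal(L/K) →* S.ActingQuot i, Function.Injective φ) ∧
      (homUnramifiedOutside K Ω T (S.Quot i)).ncard ≤
        Nat.card Gal(L/K) ^ Nat.card (S.Quot i) *
          Nat.card (DiscreteHom (GaloisGroupOutside L Ω (placesAbove T L)) (S.factor i)) *
        (homUnramifiedOutside K Ω T (G ⧸ S.term i.succ)).ncard := by
  obtain ⟨φ₀, h₀, htop, hle⟩ := exists_ncard_le_homFibre_mul (K := K) (Ω := Ω) hT (S.proj i)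
  rw [S.ker_proj] at htop hle
  set C := Subgroup.centralizer (S.factor i : Set (S.Quot i))
  let χ : Gal(Ω/K) →* S.ActingQuot i := (QuotientGroup.mk' C).comp φ₀
  have hχ : χ ∈ homUnramifiedOutside K Ω T (S.ActingQuot i) := comp_mem_homUnramifiedOutside h₀ _
  obtain ⟨hfin, hgal⟩ := finiteDimensional_and_isGalois_fixedField_ker hχ.1
  have hunr : UnramifiedOutside K (IntermediateField.fixedField χ.ker) T :=
    unramifiedOutside_of_le_max (fixedField_ker_le hχ.2)
  obtain ⟨ψ, hψ⟩ := exists_injective_gal_fixedField_ker hχ.1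
  refine ⟨IntermediateField.fixedField χ.ker, ⟨hfin, hgal, hunr⟩, fun hi ↦ ?_, ⟨ψ, hψ⟩, ?_⟩
  · have : χ = 1 := by
      rw [show χ = (QuotientGroup.mk' C).comp φ₀ from rfl, htop (S.factor_eq_top hi),
        MonoidHom.comp_one]
    rw [this, MonoidHom.ker_one]
    exact InfiniteGalois.fixedField_bot
  · refine hle.trans (Nat.mul_le_mul_right _ (ncard_homFibre_le hT _ h₀ hunr ?_ ?_))
    · intro σ hσ
      rw [fixingSubgroup_fixedField_ker hχ.1] at hσ
      exact (QuotientGroup.eq_one_iff _).1 hσ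
    · exact (Nat.card_le_card_of_injective ψ hψ).trans
        (Nat.card_le_card_of_surjective _ (QuotientGroup.mk'_surjective C))

theorem NormalSeries.card_discreteHom_le_ncard (hT : T.Finite) :
    Nat.card (DiscreteHom (GaloisGroupOutside K Ω T) G) ≤
      (homUnramifiedOutside K Ω T (G ⧸ S.term 0)).ncard := by
  rw [Nat.card_congr (discreteHomEquivHomUnramifiedOutside K Ω T G), Nat.card_coe_set_eq]
  refine Set.ncard_le_ncard_of_injOn (QuotientGroup.mk' (S.term 0)).comp
    (fun φ hφ ↦ comp_mem_homUnramifiedOutside hφ _) ?_ (finite_homUnramifiedOutside Ω _ hT)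
  intro φ _ φ' _ h
  ext σ
  have := QuotientGroup.eq.1 (DFunLike.congr_fun h σ)
  rw [S.term_zero, Subgroup.mem_bot, inv_mul_eq_one] at this
  exact this

end NormalSeriesStep

theorem theorem4p2 {K Ω : Type*} [Field K] [NumberField K] [Field Ω] [Algebra K Ω]
    [IsAlgClosure K Ω] {G : Type*} [Group G] [Finite G] {m : ℕ} (S : NormalSeries G m)
    (T : Set (NFPlace K)) (hT : T.Finite) :
    Finite (DiscreteHom (GaloisGroupOutside K Ω T) G) ∧
    ∃ L : Fin m → IntermediateField K Ω,
      (∀ i, FiniteDimensional K (L i) ∧ IsGalois K (L i) ∧ UnramifiedOutside K (L i) T) ∧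
      (∀ i : Fin m, (i : ℕ) + 1 = m → L i = ⊥) ∧
      (∀ i, ∃ φ : Gal(L i/K) →* S.ActingQuot i, Function.Injective φ) ∧
      (∀ i, Finite (DiscreteHom (GaloisGroupOutside (L i) Ω (placesAbove T (L i)))
        (S.factor i))) ∧
      Nat.card (DiscreteHom (GaloisGroupOutside K Ω T) G) ≤
        ∏ i : Fin m, Nat.card Gal(L i/K) ^ Nat.card (S.Quot i) *
          Nat.card (DiscreteHom (GaloisGroupOutside (L i) Ω (placesAbove T (L i)))
            (S.factor i)) := by
  have : IsGalois K Ω := IsAlgClosure.isGalois K Ω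
  refine ⟨finite_discreteHom_galoisGroupOutside Ω G hT, ?_⟩
  choose L hL hbot hinj hle using S.exists_field_step (K := K) (Ω := Ω) hT
  refine ⟨L, hL, hbot, hinj, fun i ↦ ?_, (S.card_discreteHom_le_ncard hT).trans
    (Fin.le_prod_of_le_mul (fun j ↦ (homUnramifiedOutside K Ω T (G ⧸ S.term j)).ncard) _ hle
      S.ncard_last_le_one)⟩
  have := (hL i).1
  have := NumberField.of_module_finite K (L i)
  exact finite_discreteHom_galoisGroupOutside Ω _ (finite_placesAbove hT (L i))
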